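/- Let $s_1,s_2,\dots$ be i.i.d. observations with law $P$ (in the application $s=(y,r,a,z)$), let $G(s,\theta)\in\mathbb R^q$ be estimating functions, measurable in $s$, with parameter $\theta\in\mathbb R^p$, and let $\hat G_n(\theta)=\frac1n\sum_{i=1}^n G(s_i,\theta)$. Let $\Theta\subset\mathbb R^p$ be compact and $\theta_0\in\Theta$ the true value. Let $W$ be a symmetric positive semi-definite $q\times q$ matrix. Two-step GMM estimator: $\tilde\theta$ minimizes $\hat G_n(\theta)^{\mathrm T}\hat G_n(\theta)$ over $\Theta$; $\hat W=W_n(\tilde\theta)$; and $\hat\theta$ minimizes $\hat G_n(\theta)^{\mathrm T}\hat W\hat G_n(\theta)$ over $\Theta$. Here $\theta\mapsto W_n(\theta)$ is a (possibly data-dependent) matrix-valued function with limit $W$ at $\theta_0$ in the following sense: for every $\varepsilon>0$ there is $\delta>0$ such that, with probability approaching one, $\|W_n(\theta)-W\|<\varepsilon$ for all $\theta\in\Theta$ with $\|\theta-\theta_0\|<\delta$ (for a nonrandom weight function $W(\theta)$ that does not depend on $n$ this is $W(\theta)\to W$ as $\theta\to\theta_0$ in $\Theta$). Assume (consistency hypotheses)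 that $E[G(s,\theta_0)]=0$; $E[G(s,\theta)]=0$ with $\theta\in\Theta$ only if $\theta=\theta_0$, and also $W\,E[G(s,\theta)]=0$ with $\theta\in\Theta$ only if $\theta=\theta_0$ (the same condition when $W$ is invertible); with probability one $G(s,\cdot)$ is continuous on $\Theta$; and $E[\sup_{\theta\in\Theta}\|G(s,\theta)\|]<\infty$. Assume further (regularity conditions) that (i) $\theta_0$ is an interior point of $\Theta$; (ii) with probability one $G(s,\cdot)$ is continuously differentiable on a fixed open neighbourhood $\mathcal N$ of $\theta_0$; (iii) $E[\|G(s,\theta_0)\|^2]<\infty$ and $E[\sup_{\theta\in\mathcal N}\|\nabla_\theta G(s,\theta)\|]<\infty$; (iv) the $q\times p$ matrix $H=E[\nabla_\theta G(s,\theta_0)]$ has full column rank $p$, and $H^{\mathrm T}WH$ is invertible (automatic when $W$ is invertible). Then, with $\Omega=E[G(s,\theta_0)G(s,\theta_0)^{\mathrm T}]$ and $\Delta=(H^{\mathrm T}WH)^{-1}H^{\mathrm T}W\Omega WH(H^{\mathrm T}WH)^{-1}$, the matrix $\Delta$ is positive semi-definite and $$\sqrt n(\hat\theta-\theta_0)\xrightarrow{\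 \mathscr L\ }N(0,\Delta)\qquad(n\to\infty).$$ -/

import Mathlib

open MeasureTheory ProbabilityTheory Filter Topology Matrix

-- Matrices carry the Euclidean (Frobenius) norm, the square root of the sum of squared entries.
attribute [local instance] Matrix.frobeniusNormedAddCommGroup

namespace GMM

variable {𝒮 : Type*} {p q : ℕ}

/-- The sample version `(1/n) ∑_{i < n} G(sᵢ, θ)` of the estimating functions `G`, for a realised
sequence of observations `s₀, s₁, …`. -/
noncomputable def sampleMoment
    (G : 𝒮 → EuclideanSpace ℝ (Fin p) → EuclideanSpace ℝ (Fin q)) (s : ℕ → 𝒮) (n : ℕ)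
    (θ : EuclideanSpace ℝ (Fin p)) : EuclideanSpace ℝ (Fin q) :=
  (n : ℝ)⁻¹ • ∑ i ∈ Finset.range n, G (s i) θ

/-- The objective function `Ĝₙ(θ)ᵀ A Ĝₙ(θ)` with weight matrix `A`. -/
noncomputable def objective
    (G : 𝒮 → EuclideanSpace ℝ (Fin p) → EuclideanSpace ℝ (Fin q))
    (A : Matrix (Fin q) (Fin q) ℝ) (s : ℕ → 𝒮) (n : ℕ)
    (θ : EuclideanSpace ℝ (Fin p)) : ℝ :=
  (sampleMoment G s n θ).ofLp ⬝ᵥ (A *ᵥ (sampleMoment G s n θ).ofLp)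

/-- `θ` is a minimiser of `Q` over the set `Θ` (a value of `argmin_Θ Q`). -/
def IsArgmin (Θ : Set (EuclideanSpace ℝ (Fin p))) (Q : EuclideanSpace ℝ (Fin p) → ℝ)
    (θ : EuclideanSpace ℝ (Fin p)) : Prop :=
  θ ∈ Θ ∧ IsMinOn Q Θ θ

/-- The `q × p` Jacobian matrix `∇_θ f` at `θ`; its `(m, k)` entry is `∂f_m / ∂θ_k`. -/
noncomputable def jacobian (f : EuclideanSpace ℝ (Fin p) → EuclideanSpace ℝ (Fin q))
    (θ : EuclideanSpace ℝ (Fin p)) : Matrix (Fin q) (Fin p) ℝ :=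
  Matrix.of fun m k => (fderiv ℝ f θ (EuclideanSpace.single k 1)) m

variable [MeasurableSpace 𝒮]

/-- The population moment `E[G(s, θ)]`, where `s` has law `P`. -/
noncomputable def populationMoment (P : Measure 𝒮)
    (G : 𝒮 → EuclideanSpace ℝ (Fin p) → EuclideanSpace ℝ (Fin q))
    (θ : EuclideanSpace ℝ (Fin p)) : EuclideanSpace ℝ (Fin q) :=
  ∫ s, G s θ ∂P

/-- The expected Jacobian `E[∇_θ G(s, θ)]`, entry by entry. -/
noncomputable def meanJacobian (P : Measure 𝒮)
    (G : 𝒮 → EuclideanSpace ℝ (Fin p) → EuclideanSpace ℝ (Fin q))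
    (θ : EuclideanSpace ℝ (Fin p)) : Matrix (Fin q) (Fin p) ℝ :=
  Matrix.of fun m k => ∫ s, jacobian (G s) θ m k ∂P

/-- The second moment matrix `E[G(s, θ) G(s, θ)ᵀ]`, entry by entry. -/
noncomputable def secondMoment (P : Measure 𝒮)
    (G : 𝒮 → EuclideanSpace ℝ (Fin p) → EuclideanSpace ℝ (Fin q))
    (θ : EuclideanSpace ℝ (Fin p)) : Matrix (Fin q) (Fin q) ℝ :=
  Matrix.of fun m l => ∫ s, G s θ m * G s θ l ∂P

/-- `(Hᵀ W H)⁻¹ Hᵀ W Ω W H (Hᵀ W H)⁻¹`. -/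
noncomputable def asymptoticCov (H : Matrix (Fin q) (Fin p) ℝ)
    (W Ω : Matrix (Fin q) (Fin q) ℝ) : Matrix (Fin p) (Fin p) ℝ :=
  (Hᵀ * W * H)⁻¹ * Hᵀ * W * Ω * W * H * (Hᵀ * W * H)⁻¹

/-- The (possibly data-dependent) weight functions `θ ↦ Wₙ(θ)` converge in probability to the
matrix `W` at `θ₀`: for every `ε > 0` there is a neighbourhood of `θ₀` on which, with probability
approaching one, `Wₙ(θ)` stays within `ε` of `W`. For a nonrandom function `θ ↦ W(θ)` that does not
depend on `n` this says that `W(θ) → W` as `θ → θ₀` in `Θ`. -/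
def WeightConsistentAt {Ω : Type*} [MeasurableSpace Ω] (μ : Measure Ω)
    (Θ : Set (EuclideanSpace ℝ (Fin p))) (θ₀ : EuclideanSpace ℝ (Fin p))
    (Wn : ℕ → Ω → EuclideanSpace ℝ (Fin p) → Matrix (Fin q) (Fin q) ℝ)
    (W : Matrix (Fin q) (Fin q) ℝ) : Prop :=
  ∀ ε : ℝ, 0 < ε → ∃ δ : ℝ, 0 < δ ∧
    Tendsto (fun n => μ {ω | ∃ θ ∈ Θ, dist θ θ₀ < δ ∧ ε ≤ ‖Wn n ω θ - W‖}) atTop (𝓝 0)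

end GMM

/-!
The argument is the classical one for M-estimators, with all "in probability" bookkeeping delegated
to a filter. `GMM.inProbability μ` is the filter on `ℕ × Ω` of the events that hold with probability
approaching one, so that convergence in probability is `Tendsto` along it, `o_P` is `=o` along it,
and the analysis of the estimator is deterministic and can be carried out along an arbitrary filter.
Since `μ` enters as an outer measure, neither the first-step estimator nor the weights have to be
measurable.

* Uniform law of large numbers (`GMM.tendstoUniformlyOn_sampleMean`): for a compact set `K`, a
  random function with continuous paths and integrable envelope is an integrable random element of
  the separable Banach space `C(K, V)`, where the strong law of large numbers applies. It is used
  for `G` on `Θ` and for the partial derivatives of `G` on a closed ball around `θ₀`.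
* Consistency (`GMM.tendsto_argmin_quadratic`): the objective converges uniformly to
  `θ ↦ ⟪g θ, W (g θ)⟫`, which is nonnegative and vanishes on `Θ` only at `θ₀`. Applied with the
  identity weight it gives consistency of the first step, hence convergence of the estimated weights
  to `W`, hence consistency of the second step.
* Linearisation (`GMM.isLittleO_argmin_sub`): the first-order condition and a Taylor estimate give
  `θ̂ - θ₀ + (Hᵀ W H)⁻¹ Hᵀ W Ĝₙ(θ₀) = o_P(Ĝₙ(θ₀))`.
* Central limit theorem (`GMM.tendstoInDistribution_multivariateGaussian`), obtained from the
  one-dimensional one through characteristic functions. It shows both that `√n Ĝₙ(θ₀)` is bounded in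
  probability, so that the remainder above is negligible after scaling by `√n`, and that the linear
  term has the Gaussian limit.
-/

namespace GMM

/-! ### Convergence in probability as convergence along a filter -/

section InProbability

variable {Ω : Type*} [MeasurableSpace Ω]

/-- The filter of events `E ⊆ ℕ × Ω` that hold with probability approaching one. Measurability is
not required: `μ` is used as an outer measure. -/
def inProbability (μ : Measure Ω) : Filter (ℕ × Ω) where
  sets := {E | Tendsto (fun n => μ {ω | (n, ω) ∉ E}) atTop (𝓝 0)}
  univ_sets := by simp
  sets_of_superset {E F} hE hEF := by
    refine tendsto_of_tendsto_of_tendsto_of_le_of_le tendsto_const_nhds hE (fun _ => zero_le)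
      fun n => measure_mono fun ω hω h => hω (hEF h)
  inter_sets {E F} hE hF := by
    have h := Tendsto.add hE hF
    rw [add_zero] at h
    refine tendsto_of_tendsto_of_tendsto_of_le_of_le tendsto_const_nhds h (fun _ => zero_le)
      fun n => (measure_mono ?_).trans (measure_union_le _ _)
    intro ω hω
    by_contra hcon
    simp only [Set.mem_union, Set.mem_ofPred_eq, not_or, not_not] at hcon
    exact hω hcon

variable {μ : Measure Ω}

lemma eventually_inProbability {p : ℕ × Ω → Prop} :
    (∀ᶠ a in inProbability μ, p a) ↔ Tendsto (fun n => μ {ω | ¬ p (n, ω)}) atTop (𝓝 0) :=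
  Iff.rfl

lemma eventually_inProbability_of_ae {p : ℕ × Ω → Prop} (h : ∀ n, ∀ᵐ ω ∂μ, p (n, ω)) :
    ∀ᶠ a in inProbability μ, p a := by
  rw [eventually_inProbability]
  have : (fun n => μ {ω | ¬ p (n, ω)}) = fun _ => 0 := funext fun n => ae_iff.1 (h n)
  rw [this]
  exact tendsto_const_nhds

lemma tendsto_inProbability {E : Type*} [PseudoEMetricSpace E] {X : ℕ → Ω → E} {c : E}
    (h : TendstoInMeasure μ X atTop fun _ => c) :
    Tendsto (fun a : ℕ × Ω => X a.1 a.2) (inProbability μ) (𝓝 c) := by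
  rw [EMetric.tendsto_nhds]
  intro ε hε
  rw [eventually_inProbability]
  simpa using h ε hε

/-- A sequence which converges in distribution is bounded in probability. -/
lemma exists_measure_norm_ge_le [IsProbabilityMeasure μ] {Ω' E : Type*} [MeasurableSpace Ω']
    {μ' : Measure Ω'} [IsProbabilityMeasure μ'] [NormedAddCommGroup E] [MeasurableSpace E]
    [BorelSpace E] {X : ℕ → Ω → E} {Z : Ω' → E}
    (h : TendstoInDistribution X atTop Z (fun _ => μ) μ') {δ : ENNReal} (hδ : 0 < δ) :
    ∃ M : ℝ, 0 < M ∧ ∀ᶠ n in atTop, μ {ω | M ≤ ‖X n ω‖} ≤ δ := by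
  have hZ := h.aemeasurable_limit
  have := Measure.isProbabilityMeasure_map (μ := μ') hZ
  have hanti : Tendsto (fun M : ℕ => (μ'.map Z) {x | (M : ℝ) ≤ ‖x‖}) atTop (𝓝 0) := by
    have : ⋂ M : ℕ, {x : E | (M : ℝ) ≤ ‖x‖} = ∅ := by
      ext x
      simp only [Set.mem_iInter, Set.mem_ofPred_eq, Set.mem_empty_iff_false, iff_false, not_forall,
        not_le]
      exact exists_nat_gt _
    rw [← measure_empty (μ := μ'.map Z), ← this]
    refine tendsto_measure_iInter_atTop
      (fun M => (measurableSet_le measurable_const measurable_norm).nullMeasurableSet) ?_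
      ⟨0, measure_ne_top _ _⟩
    intro M M' hMM' x hx
    exact le_trans (Nat.cast_le.2 hMM' : (M : ℝ) ≤ M') hx
  obtain ⟨M, hM, hM0⟩ := ((hanti.eventually_lt_const hδ).and (eventually_gt_atTop 0)).exists
  refine ⟨M, by exact_mod_cast hM0, ?_⟩
  have hclosed : IsClosed {x : E | (M : ℝ) ≤ ‖x‖} := isClosed_le continuous_const continuous_norm
  have hlim := ProbabilityMeasure.limsup_measure_closed_le_of_tendsto h.tendsto hclosed
  filter_upwards [eventually_lt_of_limsup_lt (hlim.trans_lt hM)] with n hn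
  refine le_of_eq_of_le ?_ hn.le
  exact (Measure.map_apply_of_aemeasurable (h.forall_aemeasurable n) hclosed.measurableSet).symm

/-- A sequence that is `o_P` of one that converges in distribution tends to `0` in probability. -/
lemma tendstoInMeasure_sub_of_isLittleO [IsProbabilityMeasure μ] {Ω' E F : Type*}
    [MeasurableSpace Ω']
    {μ' : Measure Ω'} [IsProbabilityMeasure μ'] [NormedAddCommGroup E] [MeasurableSpace E]
    [BorelSpace E] [NormedAddCommGroup F] {X : ℕ → Ω → E} {Z : Ω' → E} {R : ℕ → Ω → F}
    (h : TendstoInDistribution X atTop Z (fun _ => μ) μ')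
    (hR : (fun a : ℕ × Ω => R a.1 a.2) =o[inProbability μ] fun a => X a.1 a.2) :
    TendstoInMeasure μ R atTop 0 := by
  rw [tendstoInMeasure_iff_norm]
  intro ε hε
  rw [ENNReal.tendsto_nhds_zero]
  intro δ hδ
  obtain ⟨M, hM, hMn⟩ := exists_measure_norm_ge_le h (ENNReal.half_pos hδ.ne')
  have hR' := (ENNReal.tendsto_nhds_zero.1 (eventually_inProbability.1
    (hR.def (c := ε / (2 * M)) (by positivity)))) (δ / 2) (ENNReal.half_pos hδ.ne')
  filter_upwards [hMn, hR'] with n h1 h2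
  rw [← ENNReal.add_halves δ]
  refine le_trans (measure_mono ?_) ((measure_union_le _ _).trans (add_le_add h1 h2))
  intro ω hω
  by_contra hcon
  simp only [Set.mem_union, Set.mem_ofPred_eq, not_or, not_le] at hcon hω
  simp only [Pi.zero_apply, sub_zero] at hω
  have : ε / (2 * M) * ‖X n ω‖ ≤ ε / (2 * M) * M := by gcongr; exact hcon.1.le
  have h3 : ε / (2 * M) * M = ε / 2 := by field_simp
  linarith [hcon.2]

end InProbability

/-! ### The uniform law of large numbers -/

section LawOfLargeNumbers

/-- A random element of `C(K, V)` is Borel measurable as soon as its values at the points of a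
countable dense subset of `K` are: these determine the preimages of closed balls, and `C(K, V)` is
second countable. -/
lemma measurable_continuousMap {𝒮 K V : Type*} [MeasurableSpace 𝒮] [TopologicalSpace K]
    [CompactSpace K] [PseudoMetricSpace V] [SecondCountableTopology V] [MeasurableSpace V]
    [BorelSpace V] [SecondCountableTopology C(K, V)] {D : Set K} (hD : D.Countable)
    (hD' : Dense D) [MeasurableSpace C(K, V)] [BorelSpace C(K, V)] {F : 𝒮 → C(K, V)}
    (hF : ∀ x ∈ D, Measurable fun s => F s x) : Measurable F := by
  have hball (g : C(K, V)) (r : ℝ) (hr : 0 ≤ r) : MeasurableSet (F ⁻¹' Metric.closedBall g r) := by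
    have : F ⁻¹' Metric.closedBall g r = ⋂ x ∈ D, {s | dist (F s x) (g x) ≤ r} := by
      ext s
      simp only [Set.mem_preimage, Metric.mem_closedBall, ContinuousMap.dist_le hr, Set.mem_iInter,
        Set.mem_ofPred_eq]
      refine ⟨fun h x _ => h x, fun h x => ?_⟩
      have hc : IsClosed {x | dist (F s x) (g x) ≤ r} :=
        isClosed_le (by fun_prop) continuous_const
      exact hc.closure_subset_iff.2 h (hD' x)
    rw [this]
    exact MeasurableSet.biInter hD fun x hx =>
      measurableSet_le ((hF x hx).dist measurable_const) measurable_const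
  refine measurable_of_isOpen fun U hU => ?_
  choose! r hr hrU using fun g (hg : g ∈ U) => Metric.nhds_basis_closedBall.mem_iff.1
    (hU.mem_nhds hg)
  obtain ⟨T, hTU, hT, hTeq⟩ := TopologicalSpace.isOpen_biUnion_countable U
    (fun g => Metric.ball g (r g)) fun _ _ => Metric.isOpen_ball
  have hUeq : U = ⋃ g ∈ T, Metric.closedBall g (r g) := by
    apply Set.Subset.antisymm
    · intro g hg
      have : g ∈ ⋃ g ∈ T, Metric.ball g (r g) := by
        rw [hTeq]
        exact Set.mem_biUnion hg (Metric.mem_ball_self (hr g hg))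
      exact Set.biUnion_mono subset_rfl (fun _ _ => Metric.ball_subset_closedBall) this
    · exact Set.iUnion₂_subset fun g hg => hrU g (hTU hg)
  rw [hUeq, Set.preimage_iUnion₂]
  exact MeasurableSet.biUnion hT fun g hg => hball g _ (hr g (hTU hg)).le

/-- **Uniform law of large numbers.** With almost surely continuous paths and an integrable
envelope, the sample means converge uniformly on the compact set `K`, in probability, to the
mean, which is continuous on `K`. -/
theorem tendstoUniformlyOn_sampleMean {Ω 𝒮 E V : Type*} [MeasurableSpace Ω] [MeasurableSpace 𝒮]
    {μ : Measure Ω} [IsProbabilityMeasure μ] {P : Measure 𝒮} {S : ℕ → Ω → 𝒮}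
    (hS_indep : iIndepFun S μ) (hS_law : ∀ i, HasLaw (S i) P μ)
    [MetricSpace E] [NormedAddCommGroup V] [NormedSpace ℝ V] [CompleteSpace V]
    [SecondCountableTopology V] [MeasurableSpace V] [BorelSpace V]
    {K : Set E} (hK : IsCompact K) {f : 𝒮 → E → V}
    (hmeas : ∀ x ∈ K, AEMeasurable (fun s => f s x) P)
    (hcont : ∀ᵐ s ∂P, ContinuousOn (f s) K)
    (hdom : ∫⁻ s, ⨆ x ∈ K, ‖f s x‖ₑ ∂P < ⊤) :
    ContinuousOn (fun x => ∫ s, f s x ∂P) K ∧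
      TendstoUniformlyOn
        (fun (a : ℕ × Ω) x => (a.1 : ℝ)⁻¹ • ∑ i ∈ Finset.range a.1, f (S i a.2) x)
        (fun x => ∫ s, f s x ∂P) (inProbability μ) K := by
  classical
  have : CompactSpace K := isCompact_iff_compactSpace.1 hK
  let _ : MeasurableSpace C(K, V) := borel _
  have : BorelSpace C(K, V) := ⟨rfl⟩
  obtain ⟨D, hD, hD'⟩ := TopologicalSpace.exists_countable_dense K
  have hmk : ∀ᵐ s ∂P, ∀ x ∈ D, f s x = (hmeas x x.2).mk _ s :=
    (ae_ball_iff hD).2 fun x _ => (hmeas x x.2).ae_eq_mk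
  -- On the measurable conull set `A` the paths are continuous and agree with measurable versions
  -- on the countable dense set `D`.
  obtain ⟨A, hA_ae, hA, hAsub⟩ := (hcont.and hmk).exists_measurable_mem
  let F : 𝒮 → C(K, V) := fun s =>
    if h : s ∈ A then ⟨K.domRestrict (f s), (hAsub s h).1.domRestrict⟩ else 0
  have hF_apply {s : 𝒮} (hs : s ∈ A) (x : K) : F s x = f s x := by
    simp only [F, dif_pos hs]
    rfl
  have hF_meas : Measurable F := by
    refine measurable_continuousMap hD hD' fun x hx => ?_
    have : (fun s => F s x) = A.indicator ((hmeas x x.2).mk _) := by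
      ext s
      by_cases hs : s ∈ A
      · rw [hF_apply hs, Set.indicator_of_mem hs, (hAsub s hs).2 x hx]
      · simp [F, hs]
    rw [this]
    exact (hmeas x x.2).measurable_mk.indicator hA
  have hF_int : Integrable F P := by
    refine ⟨hF_meas.aestronglyMeasurable, ?_⟩
    refine lt_of_le_of_lt (lintegral_mono_ae ?_) hdom
    filter_upwards [hA_ae] with s hs
    by_cases htop : ⨆ x ∈ K, ‖f s x‖ₑ = ⊤
    · rw [htop]; exact le_top
    have : ‖F s‖ ≤ (⨆ x ∈ K, ‖f s x‖ₑ).toReal := by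
      refine (ContinuousMap.norm_le _ ENNReal.toReal_nonneg).2 fun x => ?_
      rw [hF_apply hs, ← toReal_enorm]
      exact ENNReal.toReal_mono htop (le_iSup₂ (f := fun x _ => ‖f s x‖ₑ) x.1 x.2)
    rw [← ofReal_norm]
    exact (ENNReal.ofReal_le_ofReal this).trans ENNReal.ofReal_toReal_le
  have hF_ident (i : ℕ) : IdentDistrib (fun ω => F (S i ω)) (fun ω => F (S 0 ω)) μ μ :=
    IdentDistrib.comp (f := S i) (g := S 0)
      ⟨(hS_law i).aemeasurable, (hS_law 0).aemeasurable,
        (hS_law i).map_eq.trans (hS_law 0).map_eq.symm⟩ hF_meas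
  have hF_map : Integrable F (μ.map (S 0)) := by rwa [(hS_law 0).map_eq]
  have hlln := strong_law_ae (μ := μ) (fun i ω => F (S i ω))
    (hF_map.comp_aemeasurable (hS_law 0).aemeasurable)
    (fun i j hij => (hS_indep.indepFun hij).comp hF_meas hF_meas) hF_ident
  have hmean : ∫ ω, F (S 0 ω) ∂μ = ∫ s, F s ∂P := by
    rw [← (hS_law 0).map_eq, integral_map (hS_law 0).aemeasurable hF_map.aestronglyMeasurable]
  have heval (x : K) : (∫ s, F s ∂P) x = ∫ s, f s x ∂P := by
    rw [← ContinuousMap.evalCLM_apply ℝ x, ← ContinuousLinearMap.integral_comp_comm _ hF_int]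
    refine integral_congr_ae ?_
    filter_upwards [hA_ae] with s hs
    exact hF_apply hs x
  have hSA : ∀ᵐ ω ∂μ, ∀ i, S i ω ∈ A :=
    ae_all_iff.2 fun i => ae_of_ae_map (hS_law i).aemeasurable (by rwa [(hS_law i).map_eq])
  refine ⟨?_, ?_⟩
  · rw [continuousOn_iff_continuous_domRestrict]
    convert! (∫ s, F s ∂P).continuous using 1
    ext x
    exact (heval x).symm
  · have hconv := tendsto_inProbability (tendstoInMeasure_of_tendsto_ae (μ := μ) (fun n => ?_)
      (hlln.mono fun ω h => by rwa [hmean] at h))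
    · rw [ContinuousMap.tendsto_iff_tendstoUniformly, Metric.tendstoUniformly_iff] at hconv
      rw [Metric.tendstoUniformlyOn_iff]
      intro ε hε
      filter_upwards [hconv ε hε, eventually_inProbability_of_ae (p := fun a => ∀ i, S i a.2 ∈ A)
        fun _ => hSA] with a ha haA x hx
      have := ha ⟨x, hx⟩
      rw [heval] at this
      convert this using 2
      simp [hF_apply (haA _)]
    · have (i : ℕ) : AEStronglyMeasurable (fun ω => F (S i ω)) μ :=
        (hF_meas.comp_aemeasurable (hS_law i).aemeasurable).aestronglyMeasurable
      exact (Finset.aestronglyMeasurable_fun_sum _ fun i _ => this i).const_smul (n : ℝ)⁻¹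

end LawOfLargeNumbers

/-! ### Minimisers of quadratic forms along a filter -/

section Expansion

open scoped RealInnerProductSpace

variable {α E F : Type*} {l : Filter α}
  [NormedAddCommGroup F] [InnerProductSpace ℝ F]

/-- **Consistency.** Along any filter, minimisers over a compact set of the quadratic forms
`⟪f a θ, T a (f a θ)⟫` converge to `θ₀` if `f` and `T` converge to a limit whose quadratic form is
nonpositive only at `θ₀`. Along every ultrafilter the minimisers have a limit in `K`, and the
limiting quadratic form is at most `0` there. -/
lemma tendsto_argmin_quadratic [TopologicalSpace E] {K : Set E} (hK : IsCompact K) {θ₀ : E}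
    (hθ₀ : θ₀ ∈ K) {f : α → E → F} {g : E → F} (hg : ContinuousOn g K)
    (hfg : TendstoUniformlyOn f g l K) {T : α → F →L[ℝ] F} {W : F →L[ℝ] F}
    (hT : Tendsto T l (𝓝 W)) (hg₀ : g θ₀ = 0)
    (hident : ∀ θ ∈ K, ⟪g θ, W (g θ)⟫ ≤ 0 → θ = θ₀) {x : α → E}
    (hx : ∀ᶠ a in l, x a ∈ K ∧ IsMinOn (fun θ => ⟪f a θ, T a (f a θ)⟫) K (x a)) :
    Tendsto x l (𝓝 θ₀) := by
  rw [tendsto_iff_ultrafilter]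
  intro u hu
  obtain ⟨θ, hθ, hxθ⟩ := hK.ultrafilter_le_nhds' (u.map x)
    (mem_map.2 (hu (hx.mono fun a ha => ha.1)))
  have hxθ' : Tendsto x u (𝓝[K] θ) :=
    tendsto_nhdsWithin_iff.2 ⟨hxθ, hu (hx.mono fun a ha => ha.1)⟩
  have hfu : TendstoUniformlyOn f g u K := fun v hv => hu (hfg v hv)
  have hTu : Tendsto T u (𝓝 W) := hT.mono_left hu
  have hlim {y : α → E} {z : E} (hy : Tendsto (fun a => f a (y a)) u (𝓝 (g z))) :
      Tendsto (fun a => ⟪f a (y a), T a (f a (y a))⟫) u (𝓝 ⟪g z, W (g z)⟫) :=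
    hy.inner ((isBoundedBilinearMap_apply.continuous.tendsto (W, g z)).comp (hTu.prodMk_nhds hy))
  have h1 := hlim (hfu.tendsto_comp (hg θ hθ) hxθ')
  have h2 := hlim (y := fun _ => θ₀) (hfu.tendsto_at hθ₀)
  have hle : ⟪g θ, W (g θ)⟫ ≤ ⟪g θ₀, W (g θ₀)⟫ :=
    le_of_tendsto_of_tendsto h1 h2 (hu (hx.mono fun a ha => ha.2 hθ₀))
  rw [hg₀, inner_zero_left] at hle
  rw [← hident θ hθ hle]
  exact hxθ

variable [NormedAddCommGroup E]

/-- First-order expansion at `θ₀` along `x a → θ₀` for functions whose derivatives converge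
to `H` jointly in the index and the point. -/
lemma isLittleO_taylor [NormedSpace ℝ E] {f : α → E → F} {θ₀ : E} {H : E →L[ℝ] F}
    (hdiff : ∀ᶠ b in l ×ˢ 𝓝 θ₀, DifferentiableAt ℝ (f b.1) b.2)
    (hderiv : Tendsto (fun b : α × E => fderiv ℝ (f b.1) b.2) (l ×ˢ 𝓝 θ₀) (𝓝 H))
    {x : α → E} (hx : Tendsto x l (𝓝 θ₀)) :
    (fun a => f a (x a) - f a θ₀ - H (x a - θ₀)) =o[l] fun a => x a - θ₀ := by
  rw [Asymptotics.isLittleO_iff]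
  intro c hc
  obtain ⟨s, hs, t, ht, hst⟩ := eventually_prod_iff.1
    (hdiff.and (hderiv.eventually (Metric.closedBall_mem_nhds H hc)))
  obtain ⟨r, hr, hrt⟩ := Metric.eventually_nhds_iff_ball.1 ht
  filter_upwards [hs, hx.eventually (Metric.ball_mem_nhds θ₀ hr)] with a ha hxa
  refine (convex_ball θ₀ r).norm_image_sub_le_of_norm_fderiv_le' (𝕜 := ℝ)
    (fun y hy => (hst ha (hrt y hy)).1) (fun y hy => ?_) (Metric.mem_ball_self hr) hxa
  simpa [dist_eq_norm] using (hst ha (hrt y hy)).2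

variable [InnerProductSpace ℝ E] [CompleteSpace E] [CompleteSpace F]

/-- The first-order condition for a local minimiser of `θ ↦ ⟪f θ, T (f θ)⟫`. The weight `T` need not
be self-adjoint, which is why its symmetrisation appears. -/
lemma adjoint_fderiv_apply_eq_zero {f : E → F} {T : F →L[ℝ] F} {x : E}
    (hf : DifferentiableAt ℝ f x) (hmin : IsLocalMin (fun θ => ⟪f θ, T (f θ)⟫) x) :
    (fderiv ℝ f x).adjoint ((T + T.adjoint) (f x)) = 0 := by
  have h0 := hmin.hasFDerivAt_eq_zero
    (hf.hasFDerivAt.inner ℝ ((T.hasFDerivAt).comp x hf.hasFDerivAt))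
  refine ext_inner_left ℝ fun v => ?_
  have hv := congrArg (fun L : E →L[ℝ] ℝ => L v) h0
  simp [fderivInnerCLM_apply] at hv
  rw [ContinuousLinearMap.adjoint_inner_right, inner_zero_right, _root_.add_apply,
    inner_add_right, ContinuousLinearMap.adjoint_inner_right, real_inner_comm (f x)]
  linarith

lemma tendsto_adjoint {D : α → E →L[ℝ] F} {H : E →L[ℝ] F} (hD : Tendsto D l (𝓝 H)) :
    Tendsto (fun a => (D a).adjoint) l (𝓝 H.adjoint) :=
  (ContinuousLinearMap.adjoint.continuous.tendsto H).comp hD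

lemma tendsto_adjoint_comp {D : α → E →L[ℝ] F} {H : E →L[ℝ] F} (hD : Tendsto D l (𝓝 H))
    {T : α → F →L[ℝ] F} {W : F →L[ℝ] F} (hT : Tendsto T l (𝓝 W)) :
    Tendsto (fun a => (D a).adjoint ∘L T a) l (𝓝 (H.adjoint ∘L W)) := by
  have h := ((ContinuousLinearMap.compL ℝ F F E).continuous₂.tendsto (H.adjoint, W)).comp
    ((tendsto_adjoint hD).prodMk_nhds hT)
  exact h

/-- **Asymptotic linearity.** Local minimisers `x a → θ₀` of `⟪f a θ, T a (f a θ)⟫` satisfy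
`x a - θ₀ = - (H† W H)⁻¹ H† W (f a θ₀) + o(f a θ₀)`; here `B` is a left inverse of `H† W H`. -/
lemma isLittleO_argmin_sub [FiniteDimensional ℝ E] {f : α → E → F} {θ₀ : E} {H : E →L[ℝ] F}
    (hdiff : ∀ᶠ b in l ×ˢ 𝓝 θ₀, DifferentiableAt ℝ (f b.1) b.2)
    (hderiv : Tendsto (fun b : α × E => fderiv ℝ (f b.1) b.2) (l ×ˢ 𝓝 θ₀) (𝓝 H))
    {T : α → F →L[ℝ] F} {W : F →L[ℝ] F} (hT : Tendsto T l (𝓝 W)) (hW : IsSelfAdjoint W)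
    {x : α → E} (hx : Tendsto x l (𝓝 θ₀))
    (hmin : ∀ᶠ a in l, IsLocalMin (fun θ => ⟪f a θ, T a (f a θ)⟫) (x a))
    {B : E →L[ℝ] E} (hB : B ∘L H.adjoint ∘L W ∘L H = .id ℝ E) :
    (fun a => x a - θ₀ + B (H.adjoint (W (f a θ₀)))) =o[l] fun a => f a θ₀ := by
  set L : F →L[ℝ] E := B ∘L H.adjoint ∘L W with hL
  have hLH (v : E) : L (H v) = v := congrArg (fun L : E →L[ℝ] E => L v) hB
  have hD : Tendsto (fun a => fderiv ℝ (f a) (x a)) l (𝓝 H) :=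
    hderiv.comp (tendsto_id.prodMk hx)
  have hdx : ∀ᶠ a in l, DifferentiableAt ℝ (f a) (x a) :=
    (tendsto_id.prodMk hx).eventually hdiff
  have hM : Tendsto (fun a => H.adjoint ∘L (W + W.adjoint) -
      (fderiv ℝ (f a) (x a)).adjoint ∘L (T a + (T a).adjoint)) l (𝓝 0) := by
    rw [← sub_self (H.adjoint ∘L (W + W.adjoint))]
    exact tendsto_const_nhds.sub (tendsto_adjoint_comp hD (hT.add (tendsto_adjoint hT)))
  -- By the first-order condition, `H† (W + W†)` may be replaced at `f a (x a)` by its difference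
  -- from the operator that annihilates this vector, and that difference tends to `0`.
  have hLf : (fun a => L (f a (x a))) =o[l] fun a => f a (x a) := by
    have h1 : (fun a => H.adjoint ((W + W.adjoint) (f a (x a)))) =o[l] fun a => f a (x a) := by
      rw [Asymptotics.isLittleO_iff]
      intro c hc
      filter_upwards [hM.eventually (Metric.closedBall_mem_nhds 0 hc), hdx, hmin] with a ha hd hm
      have := adjoint_fderiv_apply_eq_zero hd hm
      have h2 : H.adjoint ((W + W.adjoint) (f a (x a))) = (H.adjoint ∘L (W + W.adjoint) -
          (fderiv ℝ (f a) (x a)).adjoint ∘L (T a + (T a).adjoint)) (f a (x a)) := by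
        rw [_root_.sub_apply, ContinuousLinearMap.comp_apply, ContinuousLinearMap.comp_apply,
          this, sub_zero]
      rw [h2]
      refine (ContinuousLinearMap.le_opNorm _ _).trans ?_
      gcongr
      simpa using ha
    have h2 (a : α) : L (f a (x a)) =
        ((2 : ℝ)⁻¹ • B) (H.adjoint ((W + W.adjoint) (f a (x a)))) := by
      rw [show W.adjoint = W from hW]
      simp [hL, ← two_smul ℝ (W (f a (x a)))]
    simp_rw [h2]
    exact (ContinuousLinearMap.isBigO_comp _ _ _).trans_isLittleO h1
  have hR := isLittleO_taylor hdiff hderiv hx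
  set R : α → F := fun a => f a (x a) - f a θ₀ - H (x a - θ₀) with hRdef
  have hfx (a : α) : f a (x a) = f a θ₀ + H (x a - θ₀) + R a := by simp [hRdef]
  have hf₀ : (fun a => f a θ₀) =O[l] fun a => ‖f a θ₀‖ + ‖x a - θ₀‖ :=
    .of_norm_le fun a => by linarith [norm_nonneg (x a - θ₀)]
  have hx₀ : (fun a => x a - θ₀) =O[l] fun a => ‖f a θ₀‖ + ‖x a - θ₀‖ :=
    .of_norm_le fun a => by linarith [norm_nonneg (f a θ₀)]
  have hfO : (fun a => f a (x a)) =O[l] fun a => ‖f a θ₀‖ + ‖x a - θ₀‖ := by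
    simp_rw [hfx]
    exact (hf₀.add ((H.isBigO_comp _ _).trans hx₀)).add (hR.isBigO.trans hx₀)
  have key : (fun a => x a - θ₀ + L (f a θ₀)) =o[l] fun a => ‖f a θ₀‖ + ‖x a - θ₀‖ := by
    have h3 (a : α) : x a - θ₀ + L (f a θ₀) = L (f a (x a)) - L (R a) := by
      rw [hfx, map_add, map_add, hLH]; abel
    simp_rw [h3]
    exact (hLf.trans_isBigO hfO).sub
      ((L.isBigO_comp _ _).trans_isLittleO (hR.trans_isBigO hx₀))
  -- `x a - θ₀` is controlled by `f a θ₀`, because its part in `key` can be absorbed on the left.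
  have hxO : (fun a => x a - θ₀) =O[l] fun a => f a θ₀ := by
    refine Asymptotics.IsBigO.of_bound (2 * ‖L‖ + 1) ?_
    filter_upwards [key.def (c := 1 / 2) (by norm_num)] with a ha
    have h4 : ‖x a - θ₀‖ ≤ ‖x a - θ₀ + L (f a θ₀)‖ + ‖L (f a θ₀)‖ := by
      simpa using norm_sub_le (x a - θ₀ + L (f a θ₀)) (L (f a θ₀))
    have h5 := L.le_opNorm (f a θ₀)
    rw [Real.norm_of_nonneg (by positivity)] at ha
    linarith
  exact key.trans_isBigO ((Asymptotics.isBigO_refl _ _).norm_left.add hxO.norm_left)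

end Expansion

/-! ### The multivariate central limit theorem -/

section CentralLimit

open scoped RealInnerProductSpace

/-- **Multivariate central limit theorem** for centred variables with covariance matrix `C`, the
latter given through the second moments of the linear functionals `⟪t, X 0⟫`. -/
theorem tendstoInDistribution_multivariateGaussian {Ω : Type*} [MeasurableSpace Ω]
    {μ : Measure Ω} [IsProbabilityMeasure μ] {p : ℕ} {X : ℕ → Ω → EuclideanSpace ℝ (Fin p)}
    (hindep : iIndepFun X μ) (hident : ∀ i, IdentDistrib (X i) (X 0) μ μ)
    (hX : MemLp (X 0) 2 μ) (hmean : ∫ ω, X 0 ω ∂μ = 0) {C : Matrix (Fin p) (Fin p) ℝ}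
    (hC : C.PosSemidef) (hcov : ∀ t : EuclideanSpace ℝ (Fin p),
      ∫ ω, ⟪t, X 0 ω⟫ ^ 2 ∂μ = t.ofLp ⬝ᵥ (C *ᵥ t.ofLp)) :
    TendstoInDistribution (fun (n : ℕ) ω => (√(n : ℝ))⁻¹ • ∑ i ∈ Finset.range n, X i ω) atTop id
      (fun _ => μ) (multivariateGaussian 0 C) := by
  have hXm (i : ℕ) : AEMeasurable (X i) μ := (hident i).aemeasurable_fst
  have hm (n : ℕ) : AEMeasurable (fun ω => (√(n : ℝ))⁻¹ • ∑ i ∈ Finset.range n, X i ω) μ :=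
    (Finset.aemeasurable_fun_sum _ fun i _ => hXm i).const_smul (√(n : ℝ))⁻¹
  refine ⟨hm, aemeasurable_id, ?_⟩
  refine ProbabilityMeasure.tendsto_iff_tendsto_charFun.2 fun t => ?_
  have hinner : Measurable fun x : EuclideanSpace ℝ (Fin p) => ⟪t, x⟫ := by fun_prop
  have hLp : MemLp (fun ω => ⟪t, X 0 ω⟫) 2 μ := hX.const_inner t
  have hmean_t : ∫ ω, ⟪t, X 0 ω⟫ ∂μ = 0 := by
    rw [integral_inner (hX.integrable one_le_two), hmean, inner_zero_right]
  have hvar : Var[fun ω => ⟪t, X 0 ω⟫; μ] = t.ofLp ⬝ᵥ (C *ᵥ t.ofLp) := by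
    rw [variance_of_integral_eq_zero hLp.aemeasurable hmean_t, ← hcov]
  have hclt := tendstoInDistribution_inv_sqrt_mul_sum_sub (P := μ)
    (X := fun i ω => ⟪t, X i ω⟫) (Y := id)
    (P' := gaussianReal 0 (Var[fun ω => ⟪t, X 0 ω⟫; μ]).toNNReal)
    ⟨aemeasurable_id, Measure.map_id⟩ hLp
    (hindep.comp (fun _ x => ⟪t, x⟫) fun _ => hinner) fun i => (hident i).comp hinner
  have hchar := ProbabilityMeasure.tendsto_iff_tendsto_charFun.1 hclt.tendsto 1
  simp only [ProbabilityMeasure.coe_mk, Measure.map_id, hmean_t, mul_zero, sub_zero] at hchar ⊢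
  rw [charFun_gaussianReal, hvar] at hchar
  rw [charFun_multivariateGaussian hC]
  have hnonneg : 0 ≤ t.ofLp ⬝ᵥ (C *ᵥ t.ofLp) := by simpa using hC.dotProduct_mulVec_nonneg t.ofLp
  convert! hchar using 2
  · rw [charFun_eq_charFunDual_toDualMap, charFunDual_eq_charFun_map_one,
      AEMeasurable.map_map_of_aemeasurable (by fun_prop) (hm _)]
    congr 2 with ω
    simp
  · simp [Real.coe_toNNReal _ hnonneg]

end CentralLimit

/-! ### Matrices, Jacobians and second moments -/

section Matrices

open scoped RealInnerProductSpace

variable {p q : ℕ}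

/-- The Frobenius norm is compatible with the Euclidean norm of vectors. -/
lemma norm_toLp_mulVec_le (A : Matrix (Fin q) (Fin p) ℝ) (v : EuclideanSpace ℝ (Fin p)) :
    ‖(WithLp.toLp 2 (A *ᵥ v.ofLp) : EuclideanSpace ℝ (Fin q))‖ ≤ ‖A‖ * ‖v‖ := by
  have h := Matrix.frobenius_norm_mul A (Matrix.replicateCol Unit v.ofLp)
  rwa [← Matrix.replicateCol_mulVec, Matrix.frobenius_norm_replicateCol,
    Matrix.frobenius_norm_replicateCol] at h

lemma norm_toEuclideanCLM_le (A : Matrix (Fin q) (Fin q) ℝ) :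
    ‖toEuclideanCLM (𝕜 := ℝ) A‖ ≤ ‖A‖ :=
  ContinuousLinearMap.opNorm_le_bound _ (norm_nonneg _) fun v => norm_toLp_mulVec_le A v

lemma jacobian_mulVec_single (f : EuclideanSpace ℝ (Fin p) → EuclideanSpace ℝ (Fin q))
    (θ : EuclideanSpace ℝ (Fin p)) (k : Fin p) :
    (WithLp.toLp 2 (jacobian f θ *ᵥ (EuclideanSpace.single k (1 : ℝ)).ofLp) :
      EuclideanSpace ℝ (Fin q)) = fderiv ℝ f θ (EuclideanSpace.single k 1) := by
  ext m
  simp [jacobian]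

lemma norm_fderiv_single_le (f : EuclideanSpace ℝ (Fin p) → EuclideanSpace ℝ (Fin q))
    (θ : EuclideanSpace ℝ (Fin p)) (k : Fin p) :
    ‖fderiv ℝ f θ (EuclideanSpace.single k 1)‖ ≤ ‖jacobian f θ‖ := by
  rw [← jacobian_mulVec_single]
  simpa using norm_toLp_mulVec_le (jacobian f θ) (EuclideanSpace.single k (1 : ℝ))

lemma inner_toEuclideanLin_left (A : Matrix (Fin q) (Fin p) ℝ) (x : EuclideanSpace ℝ (Fin p))
    (y : EuclideanSpace ℝ (Fin q)) :
    ⟪toEuclideanLin A x, y⟫ = ⟪x, toEuclideanLin Aᵀ y⟫ := by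
  rw [← conjTranspose_eq_transpose_of_trivial, toEuclideanLin_conjTranspose_eq_adjoint,
    LinearMap.adjoint_inner_right]

lemma adjoint_toEuclideanLin_apply (A : Matrix (Fin q) (Fin p) ℝ)
    (v : EuclideanSpace ℝ (Fin q)) :
    (toEuclideanLin A).toContinuousLinearMap.adjoint v = toEuclideanLin Aᵀ v :=
  ext_inner_left ℝ fun w => by
    rw [ContinuousLinearMap.adjoint_inner_right, ← inner_toEuclideanLin_left]
    rfl

lemma objective_eq_inner {𝒮 : Type*}
    (G : 𝒮 → EuclideanSpace ℝ (Fin p) → EuclideanSpace ℝ (Fin q))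
    (A : Matrix (Fin q) (Fin q) ℝ) (s : ℕ → 𝒮) (n : ℕ) :
    objective G A s n = fun θ =>
      ⟪sampleMoment G s n θ, toEuclideanCLM (𝕜 := ℝ) A (sampleMoment G s n θ)⟫ :=
  funext fun θ => by rw [inner_toEuclideanCLM]; rfl

lemma inner_toEuclideanCLM_nonpos {W : Matrix (Fin q) (Fin q) ℝ} (hW : W.PosSemidef)
    {x : EuclideanSpace ℝ (Fin q)} (hx : ⟪x, toEuclideanCLM (𝕜 := ℝ) W x⟫ ≤ 0) :
    W *ᵥ x.ofLp = 0 := by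
  rw [inner_toEuclideanCLM] at hx
  rw [← hW.dotProduct_mulVec_zero_iff]
  exact le_antisymm (by simpa using hx) (hW.dotProduct_mulVec_nonneg _)

/-- Operator-norm convergence of linear maps on a Euclidean space can be tested on the standard
basis. -/
lemma tendsto_continuousLinearMap_of_single {α F : Type*} {l : Filter α} [NormedAddCommGroup F]
    [NormedSpace ℝ F] {D : α → EuclideanSpace ℝ (Fin p) →L[ℝ] F}
    {H : EuclideanSpace ℝ (Fin p) →L[ℝ] F}
    (h : ∀ k, Tendsto (fun a => D a (EuclideanSpace.single k 1)) l
      (𝓝 (H (EuclideanSpace.single k 1)))) : Tendsto D l (𝓝 H) := by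
  have hsum (L : EuclideanSpace ℝ (Fin p) →L[ℝ] F) : L = ∑ k : Fin p,
      (EuclideanSpace.proj k : EuclideanSpace ℝ (Fin p) →L[ℝ] ℝ).smulRight
        (L (EuclideanSpace.single k 1)) := by
    ext v
    conv_lhs => rw [← (EuclideanSpace.basisFun (Fin p) ℝ).sum_repr v]
    simp
  rw [hsum H, funext fun a => hsum (D a)]
  refine tendsto_finsetSum _ fun k _ => ?_
  exact ((ContinuousLinearMap.smulRightL ℝ (EuclideanSpace ℝ (Fin p)) F
    (EuclideanSpace.proj k)).continuous.tendsto _).comp (h k)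

variable {𝒮 : Type*} [MeasurableSpace 𝒮] {P : Measure 𝒮}
  {G : 𝒮 → EuclideanSpace ℝ (Fin p) → EuclideanSpace ℝ (Fin q)} {θ : EuclideanSpace ℝ (Fin p)}

/-- The second moment of a linear functional of `G(s, θ)`, read off the second moment matrix. -/
lemma integral_inner_sq (hG : MemLp (fun s => G s θ) 2 P) (u : EuclideanSpace ℝ (Fin q)) :
    ∫ s, ⟪u, G s θ⟫ ^ 2 ∂P = u.ofLp ⬝ᵥ (secondMoment P G θ *ᵥ u.ofLp) := by
  have hcoord (m : Fin q) : MemLp (fun s => G s θ m) 2 P :=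
    (EuclideanSpace.proj m : EuclideanSpace ℝ (Fin q) →L[ℝ] ℝ).comp_memLp' hG
  have hint (m l : Fin q) : Integrable (fun s => u m * (G s θ m * G s θ l * u l)) P :=
    (((hcoord m).integrable_mul (hcoord l)).mul_const _).const_mul _
  have hexp (s : 𝒮) : ⟪u, G s θ⟫ ^ 2 = ∑ m, ∑ l, u m * (G s θ m * G s θ l * u l) := by
    rw [sq, PiLp.inner_apply, Finset.sum_mul_sum]
    refine Finset.sum_congr rfl fun m _ => Finset.sum_congr rfl fun l _ => ?_
    simp
    ring
  simp_rw [hexp]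
  rw [integral_finsetSum _ fun m _ => integrable_finsetSum _ fun l _ => hint m l]
  refine Finset.sum_congr rfl fun m _ => ?_
  rw [integral_finsetSum _ fun l _ => hint m l, mulVec, dotProduct, Finset.mul_sum]
  refine Finset.sum_congr rfl fun l _ => ?_
  rw [integral_const_mul, integral_mul_const]
  rfl

lemma posSemidef_secondMoment (hG : MemLp (fun s => G s θ) 2 P) :
    (secondMoment P G θ).PosSemidef := by
  refine .of_dotProduct_mulVec_nonneg ?_ fun u => ?_
  · ext m l
    simp [secondMoment, mul_comm]
  · have h := integral_inner_sq hG (WithLp.toLp 2 u)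
    rw [star_trivial]
    exact (integral_nonneg fun s => sq_nonneg _).trans_eq h

/-- The asymptotic covariance is the covariance of `A X`, where `A = (Hᵀ W H)⁻¹ Hᵀ W`. -/
lemma asymptoticCov_eq (H : Matrix (Fin q) (Fin p) ℝ) {W : Matrix (Fin q) (Fin q) ℝ}
    (hW : Wᵀ = W) (Ω : Matrix (Fin q) (Fin q) ℝ) :
    asymptoticCov H W Ω =
      ((Hᵀ * W * H)⁻¹ * Hᵀ * W) * Ω * ((Hᵀ * W * H)⁻¹ * Hᵀ * W)ᵀ := by
  simp only [asymptoticCov, transpose_mul, transpose_nonsing_inv, transpose_transpose, hW,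
    Matrix.mul_assoc]

end Matrices

/-! ### Measurability of directional derivatives -/

section Derivative

/-- A directional derivative is measurable in the random argument, as a limit of difference
quotients. Values of `G` outside `K` are not assumed measurable, so only steps that stay in `K` are
used. -/
lemma aemeasurable_fderiv_apply {𝒮 E F : Type*} [MeasurableSpace 𝒮] {P : Measure 𝒮}
    [NormedAddCommGroup E] [NormedSpace ℝ E] [NormedAddCommGroup F] [NormedSpace ℝ F]
    [MeasurableSpace F] [BorelSpace F] [SecondCountableTopology F] {G : 𝒮 → E → F} {K : Set E}
    (hG : ∀ x ∈ K, AEMeasurable (fun s => G s x) P) {x : E} (hx : x ∈ interior K)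
    (hdiff : ∀ᵐ s ∂P, DifferentiableAt ℝ (G s) x) (v : E) :
    AEMeasurable (fun s => fderiv ℝ (G s) x v) P := by
  have hlim : Tendsto (fun n : ℕ => x + (n : ℝ)⁻¹ • v) atTop (𝓝 x) := by
    simpa using (tendsto_const_nhds (x := x)).add
      ((tendsto_inv_atTop_nhds_zero_nat (𝕜 := ℝ)).smul_const v)
  obtain ⟨n₀, hn₀⟩ := eventually_atTop.1
    (hlim.eventually (mem_interior_iff_mem_nhds.1 hx))
  refine aemeasurable_of_tendsto_metrizable_ae atTop
    (f := fun (n : ℕ) s => ((n + n₀ : ℕ) : ℝ) • (G s (x + ((n + n₀ : ℕ) : ℝ)⁻¹ • v) - G s x))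
    (fun n => ?_) ?_
  · exact ((hG _ (hn₀ _ (Nat.le_add_left _ _))).sub (hG x (interior_subset hx))).const_smul
      ((n + n₀ : ℕ) : ℝ)
  · filter_upwards [hdiff] with s hs
    refine hs.hasFDerivAt.lim v ?_
    simp only [Real.norm_natCast]
    exact tendsto_natCast_atTop_atTop.comp (tendsto_add_atTop_nat n₀)

end Derivative

/-! ### Asymptotics of the sample moment -/

section SampleMoment

variable {𝒮 : Type*} {p q : ℕ}
  {G : 𝒮 → EuclideanSpace ℝ (Fin p) → EuclideanSpace ℝ (Fin q)}

lemma hasFDerivAt_sampleMoment {s : ℕ → 𝒮} (n : ℕ) {θ : EuclideanSpace ℝ (Fin p)}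
    (h : ∀ i, DifferentiableAt ℝ (G (s i)) θ) :
    HasFDerivAt (sampleMoment G s n)
      ((n : ℝ)⁻¹ • ∑ i ∈ Finset.range n, fderiv ℝ (G (s i)) θ) θ :=
  (HasFDerivAt.fun_sum fun i _ => (h i).hasFDerivAt).fun_const_smul (n : ℝ)⁻¹

variable {Ω : Type*} [MeasurableSpace Ω] [MeasurableSpace 𝒮]
  {μ : Measure Ω} {P : Measure 𝒮} {S : ℕ → Ω → 𝒮}
  {Θ N : Set (EuclideanSpace ℝ (Fin p))} {θ₀ : EuclideanSpace ℝ (Fin p)}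

lemma ae_forall_sample (hS_law : ∀ i, HasLaw (S i) P μ) {Q : 𝒮 → Prop} (hQ : ∀ᵐ s ∂P, Q s) :
    ∀ᵐ ω ∂μ, ∀ i, Q (S i ω) :=
  ae_all_iff.2 fun i => ae_of_ae_map (hS_law i).aemeasurable (by rwa [(hS_law i).map_eq])

lemma eventually_differentiableAt_sample (hS_law : ∀ i, HasLaw (S i) P μ) (hN_open : IsOpen N)
    (hN_mem : θ₀ ∈ N) (hG_diff : ∀ᵐ s ∂P, ContDiffOn ℝ 1 (G s) N) :
    ∀ᶠ b in inProbability μ ×ˢ 𝓝 θ₀, ∀ i, DifferentiableAt ℝ (G (S i b.1.2)) b.2 := by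
  refine ((eventually_inProbability_of_ae
    (p := fun a => ∀ i, ContDiffOn ℝ 1 (G (S i a.2)) N)
    fun _ => ae_forall_sample hS_law hG_diff).prod_mk (hN_open.mem_nhds hN_mem)).mono ?_
  intro b hb i
  exact ((hb.1 i).differentiableOn one_ne_zero).differentiableAt (hN_open.mem_nhds hb.2)

/-- In probability, the derivative of the sample moment at `θ` tends to the expected Jacobian at
`θ₀`, jointly in the sample and in `θ → θ₀`. -/
lemma tendsto_fderiv_sampleMoment [IsProbabilityMeasure μ]
    (hS_indep : iIndepFun S μ) (hS_law : ∀ i, HasLaw (S i) P μ)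
    (hG_meas : ∀ θ ∈ Θ, Measurable fun s => G s θ) (hθ₀ : θ₀ ∈ interior Θ)
    (hN_open : IsOpen N) (hN_mem : θ₀ ∈ N) (hG_diff : ∀ᵐ s ∂P, ContDiffOn ℝ 1 (G s) N)
    (hJ_dom : ∫⁻ s, ⨆ θ ∈ N, ‖jacobian (G s) θ‖ₑ ∂P < ⊤) :
    Tendsto (fun b : (ℕ × Ω) × EuclideanSpace ℝ (Fin p) =>
        fderiv ℝ (sampleMoment G (fun i => S i b.1.2) b.1.1) b.2)
      (inProbability μ ×ˢ 𝓝 θ₀)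
      (𝓝 (toEuclideanLin (meanJacobian P G θ₀)).toContinuousLinearMap) := by
  -- The ball has to lie in `Θ` as well: only there is `G` known to be measurable.
  obtain ⟨r, hr, hrsub⟩ := Metric.nhds_basis_closedBall.mem_iff.1
    ((isOpen_interior.inter hN_open).mem_nhds ⟨hθ₀, hN_mem⟩)
  have hB_nhds := Metric.closedBall_mem_nhds θ₀ hr
  refine tendsto_continuousLinearMap_of_single fun k => ?_
  have hmeas : ∀ θ ∈ Metric.closedBall θ₀ r,
      AEMeasurable (fun s => fderiv ℝ (G s) θ (EuclideanSpace.single k 1)) P := fun θ hθ => by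
    refine aemeasurable_fderiv_apply (fun x hx => (hG_meas x hx).aemeasurable) (hrsub hθ).1 ?_ _
    filter_upwards [hG_diff] with s hs
    exact (hs.differentiableOn one_ne_zero).differentiableAt (hN_open.mem_nhds (hrsub hθ).2)
  have hdom : ∫⁻ s, ⨆ θ ∈ Metric.closedBall θ₀ r,
      ‖fderiv ℝ (G s) θ (EuclideanSpace.single k 1)‖ₑ ∂P < ⊤ := by
    refine lt_of_le_of_lt (lintegral_mono fun s => ?_) hJ_dom
    refine iSup₂_le fun θ hθ => le_trans ?_ (le_iSup₂ θ (hrsub hθ).2)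
    exact enorm_le_iff_norm_le.2 (norm_fderiv_single_le _ _ _)
  obtain ⟨hcont, hunif⟩ := tendstoUniformlyOn_sampleMean hS_indep hS_law
    (isCompact_closedBall θ₀ r) (f := fun s θ => fderiv ℝ (G s) θ (EuclideanSpace.single k 1))
    hmeas (by
      filter_upwards [hG_diff] with s hs
      exact ((hs.continuousOn_fderiv_of_isOpen hN_open le_rfl).mono
        fun θ hθ => (hrsub hθ).2).clm_apply continuousOn_const) hdom
  have hint : Integrable (fun s => fderiv ℝ (G s) θ₀ (EuclideanSpace.single k 1)) P := by
    refine ⟨(hmeas θ₀ (mem_of_mem_nhds hB_nhds)).aestronglyMeasurable, ?_⟩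
    exact lt_of_le_of_lt (lintegral_mono fun s => le_iSup₂
      (f := fun θ _ => ‖fderiv ℝ (G s) θ (EuclideanSpace.single k 1)‖ₑ) θ₀
      (mem_of_mem_nhds hB_nhds)) hdom
  have hlim : ∫ s, fderiv ℝ (G s) θ₀ (EuclideanSpace.single k 1) ∂P =
      (toEuclideanLin (meanJacobian P G θ₀)).toContinuousLinearMap
        (EuclideanSpace.single k 1) := by
    ext m
    have := (EuclideanSpace.proj m : EuclideanSpace ℝ (Fin q) →L[ℝ] ℝ).integral_comp_comm hint
    simp only [EuclideanSpace.coe_proj] at this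
    rw [← this]
    simp [meanJacobian, jacobian]
  rw [← hlim]
  have hfst : Tendsto Prod.fst (inProbability μ ×ˢ 𝓝 θ₀) (inProbability μ) := tendsto_fst
  have hunif' : TendstoUniformlyOn
      (fun (b : (ℕ × Ω) × EuclideanSpace ℝ (Fin p)) θ => (b.1.1 : ℝ)⁻¹ •
        ∑ i ∈ Finset.range b.1.1, fderiv ℝ (G (S i b.1.2)) θ (EuclideanSpace.single k 1))
      (fun θ => ∫ s, fderiv ℝ (G s) θ (EuclideanSpace.single k 1) ∂P)
      (inProbability μ ×ˢ 𝓝 θ₀) (Metric.closedBall θ₀ r) :=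
    fun u hu => hfst.eventually (hunif u hu)
  have hsnd : Tendsto Prod.snd (inProbability μ ×ˢ 𝓝 θ₀)
      (𝓝[Metric.closedBall θ₀ r] θ₀) := by
    rw [nhdsWithin_eq_nhds.2 hB_nhds]
    exact tendsto_snd
  refine (hunif'.tendsto_comp (hcont θ₀ (mem_of_mem_nhds hB_nhds)) hsnd).congr' ?_
  filter_upwards [eventually_differentiableAt_sample hS_law hN_open hN_mem hG_diff] with b hb
  rw [(hasFDerivAt_sampleMoment b.1.1 hb).fderiv]
  simp

/-- Data-dependent weights evaluated at a consistent preliminary estimator are consistent. -/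
lemma tendsto_weight {Wn : ℕ → Ω → EuclideanSpace ℝ (Fin p) → Matrix (Fin q) (Fin q) ℝ}
    {W : Matrix (Fin q) (Fin q) ℝ} (hWn : WeightConsistentAt μ Θ θ₀ Wn W)
    {x : ℕ → Ω → EuclideanSpace ℝ (Fin p)}
    (hx : Tendsto (fun a : ℕ × Ω => x a.1 a.2) (inProbability μ) (𝓝 θ₀))
    (hxΘ : ∀ᶠ a in inProbability μ, x a.1 a.2 ∈ Θ) :
    Tendsto (fun a : ℕ × Ω => toEuclideanCLM (𝕜 := ℝ) (Wn a.1 a.2 (x a.1 a.2)))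
      (inProbability μ) (𝓝 (toEuclideanCLM (𝕜 := ℝ) W)) := by
  rw [Metric.tendsto_nhds]
  intro ε hε
  obtain ⟨δ, hδ, hlim⟩ := hWn ε hε
  have hev : ∀ᶠ a in inProbability μ,
      ¬ ∃ θ ∈ Θ, dist θ θ₀ < δ ∧ ε ≤ ‖Wn a.1 a.2 θ - W‖ := by
    simpa only [eventually_inProbability, not_not] using hlim
  filter_upwards [hev, hxΘ, hx.eventually (Metric.ball_mem_nhds θ₀ hδ)] with a ha haΘ hax
  have hlt : ‖Wn a.1 a.2 (x a.1 a.2) - W‖ < ε :=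
    lt_of_not_ge fun hge => ha ⟨_, haΘ, hax, hge⟩
  rw [dist_eq_norm, ← map_sub]
  exact (norm_toEuclideanCLM_le _).trans_lt hlt

/-- Minimisers of the GMM objective with weights converging in probability are consistent. -/
lemma tendsto_argmin_objective [IsProbabilityMeasure μ]
    (hS_indep : iIndepFun S μ) (hS_law : ∀ i, HasLaw (S i) P μ)
    (hΘ_compact : IsCompact Θ) (hθ₀ : θ₀ ∈ Θ)
    (hG_meas : ∀ θ ∈ Θ, Measurable fun s => G s θ)
    (hG_cont : ∀ᵐ s ∂P, ContinuousOn (G s) Θ)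
    (hG_dom : ∫⁻ s, ⨆ θ ∈ Θ, ‖G s θ‖ₑ ∂P < ⊤)
    (hmoment : populationMoment P G θ₀ = 0)
    {W : Matrix (Fin q) (Fin q) ℝ} (hW : W.PosSemidef)
    (hW_ident : ∀ θ ∈ Θ, W *ᵥ (populationMoment P G θ).ofLp = 0 → θ = θ₀)
    {A : ℕ → Ω → Matrix (Fin q) (Fin q) ℝ}
    (hA : Tendsto (fun a : ℕ × Ω => toEuclideanCLM (𝕜 := ℝ) (A a.1 a.2)) (inProbability μ)
      (𝓝 (toEuclideanCLM (𝕜 := ℝ) W)))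
    {x : ℕ → Ω → EuclideanSpace ℝ (Fin p)}
    (hx : ∀ n, ∀ᵐ ω ∂μ, IsArgmin Θ (objective G (A n ω) (fun i => S i ω) n) (x n ω)) :
    Tendsto (fun a : ℕ × Ω => x a.1 a.2) (inProbability μ) (𝓝 θ₀) := by
  obtain ⟨hcont, hunif⟩ := tendstoUniformlyOn_sampleMean hS_indep hS_law hΘ_compact
    (fun θ hθ => (hG_meas θ hθ).aemeasurable) hG_cont hG_dom
  refine tendsto_argmin_quadratic hΘ_compact hθ₀ hcont hunif hA hmoment
    (fun θ hθ h => hW_ident θ hθ (inner_toEuclideanCLM_nonpos hW h)) ?_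
  refine (eventually_inProbability_of_ae (p := fun a =>
    IsArgmin Θ (objective G (A a.1 a.2) (fun i => S i a.2) a.1) (x a.1 a.2)) hx).mono
    fun a ha => ?_
  rw [objective_eq_inner] at ha
  exact ha

/-- Central limit theorem for a linear image of the sample moment at `θ₀`. -/
lemma tendstoInDistribution_sampleMoment [IsProbabilityMeasure μ]
    (hS_indep : iIndepFun S μ) (hS_law : ∀ i, HasLaw (S i) P μ)
    (hG_meas : Measurable fun s => G s θ₀) (hG_sq : MemLp (fun s => G s θ₀) 2 P)
    (hmoment : populationMoment P G θ₀ = 0) {k : ℕ} (A : Matrix (Fin k) (Fin q) ℝ) :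
    TendstoInDistribution
      (fun (n : ℕ) ω => √(n : ℝ) • toEuclideanLin A (sampleMoment G (fun i => S i ω) n θ₀))
      atTop id (fun _ => μ) (multivariateGaussian 0 (A * secondMoment P G θ₀ * Aᵀ)) := by
  set L := (toEuclideanLin A).toContinuousLinearMap
  have hLG : Measurable fun s => L (G s θ₀) := L.continuous.measurable.comp hG_meas
  have hmap (i : ℕ) : μ.map (S i) = P := (hS_law i).map_eq
  have hident (i : ℕ) : IdentDistrib (S i) (S 0) μ μ :=
    ⟨(hS_law i).aemeasurable, (hS_law 0).aemeasurable, (hmap i).trans (hmap 0).symm⟩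
  have hprob : IsProbabilityMeasure P :=
    hmap 0 ▸ Measure.isProbabilityMeasure_map (hS_law 0).aemeasurable
  have hΩ := posSemidef_secondMoment hG_sq
  have hLG2 : MemLp (fun s => L (G s θ₀)) 2 P := L.comp_memLp' hG_sq
  have key := tendstoInDistribution_multivariateGaussian (μ := μ)
    (X := fun i ω => L (G (S i ω) θ₀)) (C := A * secondMoment P G θ₀ * Aᵀ)
    (hS_indep.comp (fun _ s => L (G s θ₀)) fun _ => hLG) (fun i => (hident i).comp hLG)
    ?_ ?_ (hΩ.mul_mul_conjTranspose_same A) fun t => ?_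
  · refine key.congr (fun n => ae_of_all _ fun ω => ?_) (ae_eq_refl _)
    change _ = √(n : ℝ) • toEuclideanLin A ((n : ℝ)⁻¹ • ∑ i ∈ Finset.range n, G (S i ω) θ₀)
    rw [map_smul, map_sum, smul_smul]
    congr 1
    rw [← div_eq_mul_inv, Real.sqrt_div_self]
  · rw [← hmap 0] at hLG2
    exact hLG2.comp_of_map (hS_law 0).aemeasurable
  · rw [← integral_map (f := fun s => L (G s θ₀)) (hS_law 0).aemeasurable
      hLG.aestronglyMeasurable, hmap 0,
      L.integral_comp_comm (hG_sq.integrable one_le_two)]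
    exact (congrArg L hmoment).trans (map_zero L)
  · rw [← integral_map (f := fun s => (inner ℝ t (L (G s θ₀))) ^ 2) (hS_law 0).aemeasurable
      (by fun_prop), hmap 0]
    have hadj (x : EuclideanSpace ℝ (Fin q)) :
        inner ℝ t (L x) = inner ℝ (toEuclideanLin Aᵀ t) x := by
      rw [inner_toEuclideanLin_left, transpose_transpose]
      rfl
    simp_rw [hadj]
    rw [integral_inner_sq hG_sq, ofLp_toLpLin, toLin'_apply, ← mulVec_mulVec, ← mulVec_mulVec,
      dotProduct_mulVec _ A, ← mulVec_transpose]

end SampleMoment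

end GMM

theorem theorem3 {Ω 𝒮 : Type*} [MeasurableSpace Ω] [MeasurableSpace 𝒮] {p q : ℕ}
    -- an i.i.d. sample `S 0, S 1, …` from the law `P`
    (μ : Measure Ω) [IsProbabilityMeasure μ] (P : Measure 𝒮) (S : ℕ → Ω → 𝒮)
    (hS_indep : iIndepFun S μ) (hS_law : ∀ i, HasLaw (S i) P μ)
    -- the estimating functions, the compact parameter space and the true value
    (G : 𝒮 → EuclideanSpace ℝ (Fin p) → EuclideanSpace ℝ (Fin q))
    (Θ : Set (EuclideanSpace ℝ (Fin p))) (θ₀ : EuclideanSpace ℝ (Fin p))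
    (hΘ_compact : IsCompact Θ)
    (hG_meas : ∀ θ ∈ Θ, Measurable fun s => G s θ)
    (hG_cont : ∀ᵐ s ∂P, ContinuousOn (G s) Θ)
    (hG_dom : ∫⁻ s, ⨆ θ ∈ Θ, ‖G s θ‖ₑ ∂P < ⊤)
    (hmoment : GMM.populationMoment P G θ₀ = 0)
    (hident : ∀ θ ∈ Θ, GMM.populationMoment P G θ = 0 → θ = θ₀)
    -- interior true value, differentiability, moment bounds, full rank
    (hθ₀ : θ₀ ∈ interior Θ)
    (N : Set (EuclideanSpace ℝ (Fin p))) (hN_open : IsOpen N) (hN_mem : θ₀ ∈ N)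
    (hG_diff : ∀ᵐ s ∂P, ContDiffOn ℝ 1 (G s) N)
    (hG_sq : ∫⁻ s, ‖G s θ₀‖ₑ ^ 2 ∂P < ⊤)
    (hJ_dom : ∫⁻ s, ⨆ θ ∈ N, ‖GMM.jacobian (G s) θ‖ₑ ∂P < ⊤)
    (H : Matrix (Fin q) (Fin p) ℝ) (hH : H = GMM.meanJacobian P G θ₀)
    (hH_rank : H.rank = p)
    -- the limiting weight matrix; the last two conditions hold automatically if it is invertible
    (W : Matrix (Fin q) (Fin q) ℝ) (hW : W.PosSemidef)
    (hW_ident : ∀ θ ∈ Θ, W *ᵥ (GMM.populationMoment P G θ).ofLp = 0 → θ = θ₀)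
    (hW_inv : IsUnit (Hᵀ * W * H).det)
    -- the two-step estimator: identity weight first, then the weight `Wn` at the first-step value
    (Wn : ℕ → Ω → EuclideanSpace ℝ (Fin p) → Matrix (Fin q) (Fin q) ℝ)
    (hWn : GMM.WeightConsistentAt μ Θ θ₀ Wn W)
    (θtilde θhat : ℕ → Ω → EuclideanSpace ℝ (Fin p))
    (hθtilde : ∀ n, ∀ᵐ ω ∂μ,
      GMM.IsArgmin Θ (GMM.objective G 1 (fun i => S i ω) n) (θtilde n ω))
    (hθhat_meas : ∀ n, AEMeasurable (θhat n) μ)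
    (hθhat : ∀ n, ∀ᵐ ω ∂μ,
      GMM.IsArgmin Θ (GMM.objective G (Wn n ω (θtilde n ω)) (fun i => S i ω) n) (θhat n ω))
    (Δ : Matrix (Fin p) (Fin p) ℝ)
    (hΔ : Δ = GMM.asymptoticCov H W (GMM.secondMoment P G θ₀)) :
    Δ.PosSemidef ∧
      TendstoInDistribution (fun (n : ℕ) ω => √(n : ℝ) • (θhat n ω - θ₀)) atTop id
        (fun _ => μ) (multivariateGaussian 0 Δ) := by
  have hθ₀Θ : θ₀ ∈ Θ := interior_subset hθ₀
  have hG₀ : MemLp (fun s => G s θ₀) 2 P := by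
    refine ⟨(hG_meas θ₀ hθ₀Θ).aestronglyMeasurable, ?_⟩
    rw [eLpNorm_lt_top_iff_lintegral_rpow_enorm_lt_top two_ne_zero ENNReal.ofNat_ne_top]
    simpa using hG_sq
  have hWt : Wᵀ = W := hW.isHermitian
  set A := (Hᵀ * W * H)⁻¹ * Hᵀ * W with hA
  have hΔ' : Δ = A * GMM.secondMoment P G θ₀ * Aᵀ := hΔ.trans (GMM.asymptoticCov_eq H hWt _)
  refine ⟨?_, ?_⟩
  · rw [hΔ']
    exact (GMM.posSemidef_secondMoment hG₀).mul_mul_conjTranspose_same A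
  -- first step, with the identity weight
  have htilde := GMM.tendsto_argmin_objective hS_indep hS_law hΘ_compact hθ₀Θ hG_meas hG_cont
    hG_dom hmoment PosSemidef.one (fun θ hθ h => hident θ hθ (by simpa using h))
    (A := fun _ _ => 1) tendsto_const_nhds hθtilde
  have hweight := GMM.tendsto_weight hWn htilde
    (GMM.eventually_inProbability_of_ae (p := fun a => θtilde a.1 a.2 ∈ Θ)
      fun n => (hθtilde n).mono fun ω h => h.1)
  have hhat := GMM.tendsto_argmin_objective hS_indep hS_law hΘ_compact hθ₀Θ hG_meas hG_cont
    hG_dom hmoment hW hW_ident (A := fun n ω => Wn n ω (θtilde n ω)) hweight hθhat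
  have hmin : ∀ᶠ a in GMM.inProbability μ, IsLocalMin (fun θ =>
      inner ℝ (GMM.sampleMoment G (fun i => S i a.2) a.1 θ)
        (toEuclideanCLM (𝕜 := ℝ) (Wn a.1 a.2 (θtilde a.1 a.2))
          (GMM.sampleMoment G (fun i => S i a.2) a.1 θ))) (θhat a.1 a.2) := by
    filter_upwards [hhat.eventually (isOpen_interior.mem_nhds hθ₀),
      GMM.eventually_inProbability_of_ae (p := fun a => GMM.IsArgmin Θ
        (GMM.objective G (Wn a.1 a.2 (θtilde a.1 a.2)) (fun i => S i a.2) a.1) (θhat a.1 a.2))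
        hθhat] with a ha hmin
    rw [GMM.objective_eq_inner] at hmin
    exact hmin.2.isLocalMin (mem_interior_iff_mem_nhds.1 ha)
  have hderiv := GMM.tendsto_fderiv_sampleMoment hS_indep hS_law hG_meas hθ₀ hN_open hN_mem
    hG_diff hJ_dom
  rw [← hH] at hderiv
  have hlin := GMM.isLittleO_argmin_sub
    (f := fun (a : ℕ × Ω) θ => GMM.sampleMoment G (fun i => S i a.2) a.1 θ)
    (x := fun a => θhat a.1 a.2) (B := toEuclideanCLM (𝕜 := ℝ) (Hᵀ * W * H)⁻¹)
    ((GMM.eventually_differentiableAt_sample hS_law hN_open hN_mem hG_diff).mono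
      fun b hb => (GMM.hasFDerivAt_sampleMoment b.1.1 hb).differentiableAt)
    hderiv hweight (hW.isHermitian.isSelfAdjoint.map _) hhat hmin ?_
  -- The central limit theorem is used for `-A` times the moment, which gives the limit law, and for
  -- the moment itself, which bounds the remainder.
  · have hclt := GMM.tendstoInDistribution_sampleMoment hS_indep hS_law (hG_meas θ₀ hθ₀Θ) hG₀
      hmoment (-A)
    have hclt₁ := GMM.tendstoInDistribution_sampleMoment hS_indep hS_law (hG_meas θ₀ hθ₀Θ) hG₀
      hmoment (1 : Matrix (Fin q) (Fin q) ℝ)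
    rw [show -A * GMM.secondMoment P G θ₀ * (-A)ᵀ = Δ by simp [hΔ']] at hclt
    refine tendstoInDistribution_of_tendstoInMeasure_sub _ _ hclt
      (GMM.tendstoInMeasure_sub_of_isLittleO hclt₁ ?_) fun n =>
        ((hθhat_meas n).sub_const θ₀).const_smul (√(n : ℝ))
    refine ((Asymptotics.isBigO_refl (fun a : ℕ × Ω => √(a.1 : ℝ)) _).smul_isLittleO hlin).congr
      (fun a => ?_) (fun a => ?_)
    · have h : toEuclideanCLM (𝕜 := ℝ) (Hᵀ * W * H)⁻¹
          ((toEuclideanLin H).toContinuousLinearMap.adjoint (toEuclideanCLM (𝕜 := ℝ) W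
            (GMM.sampleMoment G (fun i => S i a.2) a.1 θ₀))) =
          toEuclideanLin A (GMM.sampleMoment G (fun i => S i a.2) a.1 θ₀) := by
        rw [GMM.adjoint_toEuclideanLin_apply]
        ext1
        simp [hA, mulVec_mulVec]
      rw [h]
      simp [smul_sub]
    · simp
  · ext1 v
    change toEuclideanCLM (𝕜 := ℝ) (Hᵀ * W * H)⁻¹ ((toEuclideanLin H).toContinuousLinearMap.adjoint
      (toEuclideanCLM (𝕜 := ℝ) W (toEuclideanLin H v))) = v
    rw [GMM.adjoint_toEuclideanLin_apply]
    apply (WithLp.ofLp_injective 2)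
    have h := nonsing_inv_mul _ hW_inv
    simp only [Matrix.mul_assoc] at h
    simp [mulVec_mulVec, Matrix.mul_assoc, h]
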